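/- Let $q$ be a prime power. There is a constant $c_q$, depending only on $q$, such that for every integer $n \ge 1$, every subgroup $H$ with $SL(n,q) \le H \le GL(n,q)$, and any two cosets $aH$ and $bH$ of $H$ in $GL(n,q)$, \[ \left| \frac{\#\{x \in aH : x \text{ is regular semisimple}\}}{|aH|} - \frac{\#\{x \in bH : x \text{ is regular semisimple}\}}{|bH|} \right| \le \frac{c_q\,(\log n)^3}{n^{1/2}} . \] Here an element of $GL(n,q)$ is semisimple if every subspace of $\mathbb{F}_q^n$ invariant under it has an invariant complement, regular if its minimal polynomial equals its characteristic polynomial, and regular semisimple if it is both (equivalently, if its characteristic polynomial is squarefree). -/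

import Mathlib

open scoped Pointwise MatrixGroups

/-- An element of `GL(n, F)` is semisimple if the operator it defines on `F ^ n` is semisimple,
that is, every invariant subspace has an invariant complement. -/
def IsSemisimpleGL {n : ℕ} {F : Type*} [Field F] (g : GL (Fin n) F) : Prop :=
  Module.End.IsSemisimple (Matrix.toLin' (g : Matrix (Fin n) (Fin n) F))

/-- An element of `GL(n, F)` is regular if its minimal polynomial is its characteristic
polynomial, that is, each irreducible factor contributes a single cyclic block to its rational
canonical form. -/
def IsRegularGL {n : ℕ} {F : Type*} [Field F] (g : GL (Fin n) F) : Prop :=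
  minpoly F (g : Matrix (Fin n) (Fin n) F) = (g : Matrix (Fin n) (Fin n) F).charpoly

/-- An element of `GL(n, F)` is regular semisimple if it is regular and semisimple. -/
def IsRegularSemisimpleGL {n : ℕ} {F : Type*} [Field F] (g : GL (Fin n) F) : Prop :=
  IsRegularGL g ∧ IsSemisimpleGL g

/-- `SL(n, F)` as a subgroup of `GL(n, F)`. -/
def slSubgroup (n : ℕ) (F : Type*) [Field F] : Subgroup (GL (Fin n) F) :=
  (Matrix.SpecialLinearGroup.toGL : SL(n, F) →* GL (Fin n) F).range

/-- The proportion of regular semisimple elements in a (finite, nonempty) subset of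
`GL(n, F)`. -/
noncomputable def rsProportion {n : ℕ} {F : Type*} [Field F] (S : Set (GL (Fin n) F)) : ℝ :=
  ({x ∈ S | IsRegularSemisimpleGL x}.ncard : ℝ) / (S.ncard : ℝ)

/-!
The proportion of regular semisimple elements is nearly the same in all fibres of the determinant,
with an error `O(1 / n)` for fixed `q`; a coset of `H ≥ SL n` is a union of such fibres, so its
proportion is an average of nearly equal numbers.

A regular semisimple element has squarefree characteristic polynomial `f`, and the elements with a
given such `f` form one conjugacy class whose centralizer is the unit group of `F[X]/(f)`
(`natCard_minpoly_eq_charpoly_eq_mul`). Hence the proportion of elements of `GL n` that are regular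
semisimple with determinant `δ` is `A n c`, the sum of `w f = 1 / #(F[X]/(f))ˣ` over the squarefree
`f` of degree `n` with constant term `c = (-1) ^ n * δ` (`rsWeight`, `classWeight`). The weight is
multiplicative on coprime factors and is `1 / (q ^ d - 1)` on primes of degree `d`, and the sum of
all weights in a given degree is at most one, being a proportion.

Writing `n = ∑ deg φ` over the prime factors `φ` of `f` gives a recursion
(`mul_rsWeight_eq_sum`, `rsWeightMultiples_add`):
`n * A n c = ∑ d ≤ n, ∑ deg φ = d, d / (q ^ d - 1) * (A (n - d) (c / φ(0)) - ⋯)`,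
where the omitted term is the weight of the multiples of `φ`, at most `1 / (q ^ d - 1)`. The primes
of degree `d` are equidistributed over the constant terms up to an error of size `q ^ (d / 2 + 1)`,
because the norm from the extension of degree `d` is equidistributed and few elements of that
extension fail to generate it (`exists_card_primesWithConst_bounds`). So the inner sum is
`(∑ e, A (n - d) e) / (q - 1)`, which does not involve `c`, up to an error that is summable over `d`
(`sum_primes_bounds`). Therefore `n * A n c` is independent of `c` up to a bounded error
(`exists_abs_rsWeight_sub_le`).
-/

open Polynomial

/-! ### Conjugacy classes with squarefree characteristic polynomial -/

/-- If the minimal polynomial of `φ` is squarefree, each of its divisors is the exact annihilator of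
some vector: a vector annihilated exactly by a prime factor and one annihilated exactly by a coprime
divisor sum to a vector annihilated exactly by the product. -/
theorem exists_aeval_eq_zero_iff_dvd {F V : Type*} [Field F] [AddCommGroup V] [Module F V]
    (φ : Module.End F V) (hsq : Squarefree (minpoly F φ)) (g : F[X]) (hg : g ∣ minpoly F φ) :
    ∃ v : V, ∀ p : F[X], aeval φ p v = 0 ↔ g ∣ p := by
  induction g using WfDvdMonoid.induction_on_irreducible with
  | zero => exact absurd (zero_dvd_iff.mp hg) hsq.ne_zero
  | unit u hu => exact ⟨0, fun p => by simp [hu.dvd]⟩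
  | mul a i ha hi ih =>
    obtain ⟨va, hva⟩ := ih ((dvd_mul_left a i).trans hg)
    obtain ⟨b, hb⟩ := hg
    have hia : IsCoprime i a := by
      refine (hi.coprime_iff_not_dvd).2 fun h => hi.not_isUnit (hsq i ?_)
      rw [hb]
      exact (mul_dvd_mul_left i h).trans (dvd_mul_right _ _)
    -- `a * b` is a proper divisor of the minimal polynomial, so it does not annihilate `V`
    have hne : aeval φ (a * b) ≠ 0 := by
      intro h
      have h1 := minpoly.dvd F φ h
      rw [hb, mul_assoc] at h1
      have hab : a * b ≠ 0 := fun h0 => hsq.ne_zero (by rw [hb, mul_assoc, h0, mul_zero])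
      obtain ⟨c, hc⟩ := h1
      refine hi.not_isUnit (IsUnit.of_mul_eq_one c ?_)
      apply mul_right_cancel₀ hab
      rw [one_mul]
      conv_rhs => rw [hc]
      ring
    obtain ⟨u, hu⟩ : ∃ u, aeval φ (a * b) u ≠ 0 := by
      by_contra! h
      exact hne (LinearMap.ext h)
    set w := aeval φ (a * b) u with hw
    have hiw : aeval φ i w = 0 := by
      rw [hw, ← Module.End.mul_apply, ← map_mul, ← mul_assoc, ← hb, minpoly.aeval]
      rfl
    -- `i` kills `w ≠ 0` and generates a maximal ideal, so it generates the annihilator of `w`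
    have hw' : ∀ p : F[X], aeval φ p w = 0 → i ∣ p := by
      intro p hp
      by_contra hn
      obtain ⟨x, y, hxy⟩ := (hi.coprime_iff_not_dvd).2 hn
      apply hu
      have := congrArg (fun r => aeval φ r w) hxy
      simpa [map_add, map_mul, hiw, hp] using this.symm
    refine ⟨w + va, fun p => ⟨fun hp => ?_, ?_⟩⟩
    · have h1 : aeval φ (a * p) w = 0 := by
        have h2 : aeval φ (a * p) (w + va) = 0 := by
          rw [map_mul, Module.End.mul_apply, hp, map_zero]
        have h3 : aeval φ (a * p) va = 0 := (hva _).2 (dvd_mul_right _ _)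
        rwa [map_add, h3, add_zero] at h2
      have h4 : aeval φ (i * p) va = 0 := by
        have h2 : aeval φ (i * p) (w + va) = 0 := by
          rw [map_mul, Module.End.mul_apply, hp, map_zero]
        have h3 : aeval φ (i * p) w = 0 := by
          rw [mul_comm, map_mul, Module.End.mul_apply, hiw, map_zero]
        rwa [map_add, h3, zero_add] at h2
      exact hia.mul_dvd (hia.dvd_of_dvd_mul_left (hw' _ h1))
        (hia.symm.dvd_of_dvd_mul_left ((hva _).1 h4))
    · rintro ⟨c, rfl⟩
      have h3 : aeval φ (i * a * c) w = 0 := by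
        rw [mul_assoc, mul_comm, map_mul, Module.End.mul_apply, hiw, map_zero]
      have h4 : aeval φ (i * a * c) va = 0 := (hva _).2 ⟨i * c, by ring⟩
      rw [map_add, h3, h4, add_zero]

theorem isRegularSemisimpleGL_iff {n : ℕ} {F : Type*} [Field F] (g : GL (Fin n) F) :
    IsRegularSemisimpleGL g ↔
      minpoly F (g : Matrix (Fin n) (Fin n) F) = (g : Matrix (Fin n) (Fin n) F).charpoly ∧
        Squarefree (g : Matrix (Fin n) (Fin n) F).charpoly := by
  unfold IsRegularSemisimpleGL IsRegularGL IsSemisimpleGL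
  refine and_congr_right fun h => ?_
  rw [← h, ← Matrix.minpoly_toLin']
  refine ⟨fun hs => hs.minpoly_squarefree, fun hs => ?_⟩
  exact Module.End.isSemisimple_of_squarefree_aeval_eq_zero hs (minpoly.aeval _ _)

section ClassCount

variable {F : Type*} [Field F] {n : ℕ}

/-- An endomorphism whose minimal polynomial is squarefree of full degree is cyclic: up to a linear
isomorphism it is multiplication by the class of `X` on `F[X]/(f)`. -/
theorem exists_linearEquiv_adjoinRoot {V : Type*} [AddCommGroup V] [Module F V]
    [FiniteDimensional F V] (φ : Module.End F V) (f : F[X]) (hf : minpoly F φ = f)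
    (hsq : Squarefree f) (hdeg : f.natDegree = Module.finrank F V) :
    ∃ e : AdjoinRoot f ≃ₗ[F] V, ∀ r, e (AdjoinRoot.root f * r) = φ (e r) := by
  obtain ⟨v, hv⟩ := exists_aeval_eq_zero_iff_dvd φ (hf ▸ hsq) f (hf ▸ dvd_rfl)
  have h0 : f ≠ 0 := hsq.ne_zero
  let ψ : AdjoinRoot f →ₐ[F] Module.End F V :=
    Ideal.Quotient.liftₐ (Ideal.span {f}) (aeval φ) (fun p hp => by
      obtain ⟨c, rfl⟩ := Ideal.mem_span_singleton.1 hp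
      rw [map_mul, ← hf, minpoly.aeval, zero_mul])
  have hψ : ∀ p : F[X], ψ (AdjoinRoot.mk f p) = aeval φ p := fun p => rfl
  let L : AdjoinRoot f →ₗ[F] V := (LinearMap.applyₗ v) ∘ₗ ψ.toLinearMap
  have hL : ∀ r, L r = ψ r v := fun r => rfl
  have hinj : Function.Injective L := by
    rw [← LinearMap.ker_eq_bot, LinearMap.ker_eq_bot']
    intro r hr
    obtain ⟨p, rfl⟩ := AdjoinRoot.mk_surjective r
    rw [hL, hψ, hv] at hr
    exact AdjoinRoot.mk_eq_zero.2 hr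
  have hfin : FiniteDimensional F (AdjoinRoot f) := (AdjoinRoot.powerBasis h0).finite
  have hrank : Module.finrank F (AdjoinRoot f) = Module.finrank F V := by
    rw [(AdjoinRoot.powerBasis h0).finrank, ← hdeg]; rfl
  refine ⟨LinearEquiv.ofInjectiveOfFinrankEq L hinj hrank, fun r => ?_⟩
  have hroot : ψ (AdjoinRoot.root f) = φ := by
    have := hψ X
    simpa using this
  change L _ = φ (L _)
  rw [hL, hL, map_mul, hroot]
  rfl

/-- A linear endomorphism of `F[X]/(f)` commuting with multiplication by the class of `X` is
multiplication by an element. -/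
theorem eq_mulLeft_of_commute_root {f : F[X]} (T : Module.End F (AdjoinRoot f))
    (hT : ∀ r, T (AdjoinRoot.root f * r) = AdjoinRoot.root f * T r) (r : AdjoinRoot f) :
    T r = T 1 * r := by
  suffices h : ∀ (p : F[X]) (s : AdjoinRoot f),
      T (AdjoinRoot.mk f p * s) = AdjoinRoot.mk f p * T s by
    obtain ⟨p, rfl⟩ := AdjoinRoot.mk_surjective r
    rw [← mul_one (AdjoinRoot.mk f p), h, mul_one, mul_comm]
  intro p
  induction p using Polynomial.induction_on' with
  | add p q hp hq => intro s; rw [map_add, add_mul, map_add, hp, hq, add_mul]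
  | monomial k a =>
    intro s
    rw [← C_mul_X_pow_eq_monomial, map_mul (AdjoinRoot.mk f), map_pow (AdjoinRoot.mk f),
      AdjoinRoot.mk_X, AdjoinRoot.mk_C]
    have h1 : ∀ t : AdjoinRoot f, AdjoinRoot.of f a * t = a • t := fun t => by
      rw [Algebra.smul_def]; rfl
    rw [mul_assoc, mul_assoc, h1, h1, map_smul]
    congr 1
    induction k generalizing s with
    | zero => simp
    | succ k ih => rw [pow_succ', mul_assoc, hT, ih, mul_assoc]

/-- The elements of `GL n` with minimal and characteristic polynomial `f` form a single conjugacy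
class, the centralizer being the unit group of `F[X]/(f)`. -/
theorem natCard_minpoly_eq_charpoly_eq_mul {f : F[X]} (hf : f.Monic)
    (hsq : Squarefree f) (hdeg : f.natDegree = n) (h0 : f.coeff 0 ≠ 0) :
    Nat.card {g : GL (Fin n) F // minpoly F (g : Matrix (Fin n) (Fin n) F) = f ∧
        (g : Matrix (Fin n) (Fin n) F).charpoly = f} * Nat.card (AdjoinRoot f)ˣ =
      Nat.card (GL (Fin n) F) := by
  have hne : f ≠ 0 := hf.ne_zero
  let pb := AdjoinRoot.powerBasis hne
  have hfin : Module.Finite F (AdjoinRoot f) := pb.finite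
  let b : Module.Basis (Fin n) F (AdjoinRoot f) := pb.basis.reindex (finCongr hdeg)
  let lm := Algebra.leftMulMatrix b
  have hlminj : Function.Injective lm := Algebra.leftMulMatrix_injective b
  have hmin0 : minpoly F (AdjoinRoot.root f) = f := by
    rw [AdjoinRoot.minpoly_root hne, hf.leadingCoeff]; simp
  -- `C`, the matrix of multiplication by the root, plays the part of the companion matrix
  let C := lm (AdjoinRoot.root f)
  have hCmin : minpoly F C = f := by
    rw [minpoly.algHom_eq lm hlminj, hmin0]
  have hCchar : C.charpoly = f := by
    have h1 := charpoly_leftMulMatrix pb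
    rw [Algebra.leftMulMatrix_apply, LinearMap.charpoly_toMatrix] at h1
    change (Algebra.leftMulMatrix b _).charpoly = f
    rw [Algebra.leftMulMatrix_apply, LinearMap.charpoly_toMatrix]
    exact h1.trans hmin0
  have hCdet : IsUnit C.det := by
    rw [Matrix.det_eq_sign_charpoly_coeff, hCchar]
    simp [h0]
  let c : GL (Fin n) F := Matrix.GeneralLinearGroup.mk'' C hCdet
  have horbit : MulAction.orbit (ConjAct (GL (Fin n) F)) c =
      {g : GL (Fin n) F | minpoly F (g : Matrix (Fin n) (Fin n) F) = f ∧
        (g : Matrix (Fin n) (Fin n) F).charpoly = f} := by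
    ext g
    rw [ConjAct.mem_orbit_conjAct, isConj_comm, isConj_iff, Set.mem_ofPred_eq]
    constructor
    · rintro ⟨p, rfl⟩
      have hconj : ((p * c * p⁻¹ : GL (Fin n) F) : Matrix (Fin n) (Fin n) F) =
          (p : Matrix (Fin n) (Fin n) F) * C * ((p⁻¹ : GL (Fin n) F) : Matrix (Fin n) (Fin n) F) :=
        rfl
      rw [hconj]
      constructor
      · rw [← hCmin]
        exact minpoly.algEquiv_eq (MulSemiringAction.toAlgEquiv F (Matrix (Fin n) (Fin n) F)
          (ConjAct.toConjAct p)) C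
      · rw [← hCchar]
        rw [Matrix.coe_units_inv]
        exact Matrix.charpoly_units_conj p C
    · rintro ⟨hgm, -⟩
      let φ := Matrix.toLin' (g : Matrix (Fin n) (Fin n) F)
      obtain ⟨e, he⟩ := exists_linearEquiv_adjoinRoot φ f
        (by rw [Matrix.minpoly_toLin', hgm]) hsq (by simpa using hdeg)
      let P := LinearMap.toMatrix b (Pi.basisFun F (Fin n)) e.toLinearMap
      let Q := LinearMap.toMatrix (Pi.basisFun F (Fin n)) b e.symm.toLinearMap
      have hPQ : P * Q = 1 := by
        rw [← LinearMap.toMatrix_comp]; simp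
      have hQP : Q * P = 1 := by
        rw [← LinearMap.toMatrix_comp]; simp
      let p : GL (Fin n) F := ⟨P, Q, hPQ, hQP⟩
      refine ⟨p, ?_⟩
      rw [mul_inv_eq_iff_eq_mul]
      apply Units.ext
      change P * C = (g : Matrix (Fin n) (Fin n) F) * P
      have hg : (g : Matrix (Fin n) (Fin n) F) =
          LinearMap.toMatrix (Pi.basisFun F (Fin n)) (Pi.basisFun F (Fin n)) φ := by
        rw [LinearMap.toMatrix_eq_toMatrix', LinearMap.toMatrix'_toLin']
      have hC : C = LinearMap.toMatrix b b (LinearMap.mulLeft F (AdjoinRoot.root f)) := rfl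
      rw [hg, hC, ← LinearMap.toMatrix_comp, ← LinearMap.toMatrix_comp]
      congr 1
      ext1 r
      exact he r
  have hstab : Nat.card (MulAction.stabilizer (ConjAct (GL (Fin n) F)) c) =
      Nat.card (AdjoinRoot f)ˣ := by
    have hmem : ∀ u : (AdjoinRoot f)ˣ, ConjAct.toConjAct (Units.map lm.toMonoidHom u) ∈
        MulAction.stabilizer (ConjAct (GL (Fin n) F)) c := by
      intro u
      rw [MulAction.mem_stabilizer_iff, ConjAct.toConjAct_smul, mul_inv_eq_iff_eq_mul]
      apply Units.ext
      change lm u * lm (AdjoinRoot.root f) = lm (AdjoinRoot.root f) * lm u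
      rw [← map_mul, ← map_mul, mul_comm]
    symm
    refine Nat.card_congr (Equiv.ofBijective (fun u => ⟨_, hmem u⟩) ⟨fun u v huv => ?_, ?_⟩)
    · have h1 := congrArg (fun x => ((ConjAct.ofConjAct x.1 : GL (Fin n) F) :
        Matrix (Fin n) (Fin n) F)) huv
      exact Units.ext (hlminj h1)
    · rintro ⟨x, hx⟩
      obtain ⟨g, rfl⟩ := ConjAct.toConjAct.surjective x
      rw [MulAction.mem_stabilizer_iff, ConjAct.toConjAct_smul, mul_inv_eq_iff_eq_mul] at hx
      -- an invertible matrix commuting with `C` is in the image of the regular representation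
      have key : ∀ h : GL (Fin n) F, h * c = c * h →
          ∃ r, lm r = (h : Matrix (Fin n) (Fin n) F) := by
        intro h hh
        have hh' := congrArg (fun x : GL (Fin n) F => Matrix.toLin b b x.1) hh
        have hCl : Matrix.toLin b b C = LinearMap.mulLeft F (AdjoinRoot.root f) := by
          exact Matrix.toLin_toMatrix b b _
        change Matrix.toLin b b (h.1 * C) = Matrix.toLin b b (C * h.1) at hh'
        rw [Matrix.toLin_mul b b b, Matrix.toLin_mul b b b, hCl] at hh'
        refine ⟨Matrix.toLin b b h.1 1, ?_⟩
        apply (Matrix.toLin b b).injective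
        refine (Matrix.toLin_toMatrix b b _).trans ?_
        ext1 r
        exact (eq_mulLeft_of_commute_root (Matrix.toLin b b h.1)
          (fun s => LinearMap.congr_fun hh' s) r).symm
      obtain ⟨r, hr⟩ := key g hx
      obtain ⟨s, hs⟩ := key g⁻¹ (Commute.inv_left hx)
      have hrs : r * s = 1 := hlminj (by
        rw [map_mul, hr, hs, map_one, ← Units.val_mul, mul_inv_cancel, Units.val_one])
      refine ⟨⟨r, s, hrs, by rw [mul_comm, hrs]⟩, Subtype.ext ?_⟩
      exact congrArg ConjAct.toConjAct (Units.ext hr)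
  have h1 := Nat.card_congr
    (MulAction.orbitProdStabilizerEquivGroup (ConjAct (GL (Fin n) F)) c)
  rw [Nat.card_prod, hstab, horbit] at h1
  exact h1

end ClassCount

/-! ### Irreducible polynomials with a given constant term -/

section Primes

variable (F : Type*) [Field F] [Finite F]

theorem finite_setOf_monic_natDegree_eq (n : ℕ) :
    {f : F[X] | f.Monic ∧ f.natDegree = n}.Finite := by
  -- such a polynomial is determined by its first `n + 1` coefficients
  refine Set.Finite.of_injOn (f := fun f (i : Fin (n + 1)) => f.coeff i) (t := Set.univ)
    (fun _ _ => Set.mem_univ _) ?_ Set.finite_univ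
  rintro f ⟨-, hf⟩ g ⟨-, hg⟩ h
  refine (ext_iff_natDegree_le hf.le hg.le).2 fun i hi => ?_
  exact congrFun h ⟨i, Nat.lt_succ_of_le hi⟩

/-- The monic polynomials of degree `n` over a finite field. -/
noncomputable def monicsOfDegree (n : ℕ) : Finset F[X] :=
  (finite_setOf_monic_natDegree_eq F n).toFinset

variable {F}

@[simp]
theorem mem_monicsOfDegree {n : ℕ} {f : F[X]} :
    f ∈ monicsOfDegree F n ↔ f.Monic ∧ f.natDegree = n := by
  simp [monicsOfDegree]

open Classical in
/-- The monic irreducible polynomials of degree `d` with constant term `e`. -/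
noncomputable def primesWithConst (d : ℕ) (e : F) : Finset F[X] :=
  (monicsOfDegree F d).filter fun f => Irreducible f ∧ f.coeff 0 = e

theorem mem_primesWithConst {d : ℕ} {e : F} {f : F[X]} :
    f ∈ primesWithConst d e ↔ (f.Monic ∧ f.natDegree = d) ∧ Irreducible f ∧ f.coeff 0 = e := by
  simp [primesWithConst]

section Extension

variable {K : Type*} [Field K] [Algebra F K] [Finite K]

omit [Finite F] in
/-- For a generator of `K` over `F` the characteristic polynomial of multiplication is the minimal
polynomial, so the norm is its constant term up to sign. -/
theorem norm_eq_coeff_zero_minpoly_of_natDegree_eq {α : K}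
    (h : (minpoly F α).natDegree = Module.finrank F K) :
    Algebra.norm F α = (-1) ^ Module.finrank F K * (minpoly F α).coeff 0 := by
  have : Module.Finite F K := Module.Finite.of_finite
  have h1 : minpoly F (Algebra.lmul F K α) = minpoly F α :=
    minpoly.algHom_eq _ Algebra.lmul_injective α
  have h2 : (Algebra.lmul F K α).charpoly = minpoly F α := by
    rw [← h1]
    refine (Polynomial.eq_of_monic_of_dvd_of_natDegree_le
      (minpoly.monic (Algebra.IsIntegral.isIntegral _)) (LinearMap.charpoly_monic _)
      (LinearMap.minpoly_dvd_charpoly _) ?_)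
    rw [LinearMap.charpoly_natDegree, h1, h]
  rw [Algebra.norm_apply, LinearMap.det_eq_sign_charpoly_coeff]
  rw [← h2]

/-- The norm of an extension of finite fields is equidistributed over the nonzero values. -/
theorem exists_ncard_norm_eq : ∃ m : ℕ, m * (Nat.card F - 1) = Nat.card K - 1 ∧
    ∀ x : F, x ≠ 0 → {α : K | Algebra.norm F α = x}.ncard = m := by
  classical
  have := Fintype.ofFinite F
  have := Fintype.ofFinite K
  have : Module.Finite F K := Module.Finite.of_finite
  have hU : ∀ x : F, {α : K | Algebra.norm F α = x}.ncard =
      (Finset.univ.filter fun α : K => Algebra.norm F α = x).card := fun x => by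
    rw [← Set.ncard_coe_finset]; simp
  have hconst : ∀ x : F, x ≠ 0 → (Finset.univ.filter fun α : K => Algebra.norm F α = x).card =
      (Finset.univ.filter fun α : K => Algebra.norm F α = 1).card := by
    intro x hx
    obtain ⟨β, hβ⟩ := FiniteField.norm_surjective F K x
    have hβ0 : β ≠ 0 := by rintro rfl; exact hx (by rw [← hβ, Algebra.norm_zero])
    have hβi : Algebra.norm F β⁻¹ = x⁻¹ := by
      refine eq_inv_of_mul_eq_one_left ?_
      rw [← hβ, ← map_mul, inv_mul_cancel₀ hβ0, map_one]
    symm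
    refine Finset.card_nbij' (fun α => β * α) (fun α => β⁻¹ * α) ?_ ?_ ?_ ?_
    · intro α hα
      simp at hα ⊢
      rw [hα, hβ, mul_one]
    · intro α hα
      simp at hα ⊢
      rw [hα, hβi, inv_mul_cancel₀ hx]
    · intro α _; simp [hβ0]
    · intro α _; simp [hβ0]
  refine ⟨(Finset.univ.filter fun α : K => Algebra.norm F α = 1).card, ?_, fun x hx => by
    rw [hU, hconst x hx]⟩
  have h1 := Finset.card_eq_sum_card_fiberwise (s := (Finset.univ.erase 0 : Finset K))
    (t := (Finset.univ.erase 0 : Finset F)) (f := fun α => Algebra.norm F α) (by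
      intro α hα
      simpa [Algebra.norm_eq_zero_iff] using hα)
  rw [Finset.card_erase_of_mem (Finset.mem_univ _), Finset.card_univ, ← Nat.card_eq_fintype_card]
    at h1
  rw [h1, Finset.sum_congr rfl (g := fun _ =>
    (Finset.univ.filter fun α : K => Algebra.norm F α = 1).card), Finset.sum_const,
    Finset.card_erase_of_mem (Finset.mem_univ _), Finset.card_univ, ← Nat.card_eq_fintype_card,
    smul_eq_mul, mul_comm]
  intro x hx
  have hx0 : x ≠ 0 := Finset.ne_of_mem_erase hx
  rw [← hconst x hx0]
  congr 1
  ext α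
  simp only [Finset.mem_filter, Finset.mem_erase, Finset.mem_univ, true_and, and_true]
  refine and_iff_right_of_imp ?_
  rintro h rfl
  exact hx0 (by rw [← h, Algebra.norm_zero])

/-- Few elements of `K` lie in a proper subfield containing `F`: such an element has degree `j`
at most half that of `K`, hence is a root of `X ^ q ^ j - X`. -/
theorem ncard_natDegree_minpoly_ne_le :
    {α : K | (minpoly F α).natDegree ≠ Module.finrank F K}.ncard ≤
      Nat.card F ^ (Module.finrank F K / 2 + 1) := by
  classical
  have : Module.Finite F K := Module.Finite.of_finite
  have hq : 1 < Nat.card F := Finite.one_lt_card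
  set d := Module.finrank F K
  set q := Nat.card F
  have hsub : {α : K | (minpoly F α).natDegree ≠ d} ⊆
      ↑((Finset.Icc 1 (d / 2)).biUnion fun j => ((X ^ q ^ j - X : K[X]).roots.toFinset)) := by
    intro α hα
    have hint : IsIntegral F α := Algebra.IsIntegral.isIntegral α
    have hdvd : (minpoly F α).natDegree ∣ d := minpoly.degree_dvd hint
    obtain ⟨k, hk⟩ := hdvd
    have hpos := minpoly.natDegree_pos hint
    have hdpos : 0 < d := Module.finrank_pos
    simp only [Finset.coe_biUnion, Set.mem_iUnion, Finset.mem_coe, Finset.mem_Icc]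
    refine ⟨(minpoly F α).natDegree, ⟨hpos, ?_⟩, ?_⟩
    · have hk2 : 2 ≤ k := by
        rcases k with _ | _ | k
        · simp at hk; omega
        · simp at hk; exact absurd hk.symm hα
        · omega
      rw [Nat.le_div_iff_mul_le two_pos, hk]
      exact Nat.mul_le_mul_left _ hk2
    · rw [Multiset.mem_toFinset, mem_roots (FiniteField.X_pow_card_pow_sub_X_ne_zero K hpos.ne' hq)]
      have h1 := (minpoly.irreducible hint).natDegree_dvd_iff_dvd_X_pow_card_pow_sub_X.1 dvd_rfl
      have h2 := (minpoly.dvd_iff.1 h1)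
      simpa [IsRoot.def] using h2
  refine (Set.ncard_le_ncard hsub (Finset.finite_toSet _)).trans ?_
  rw [Set.ncard_coe_finset]
  refine Finset.card_biUnion_le.trans ?_
  refine (Finset.sum_le_sum (g := fun j => q ^ j) fun j hj => ?_).trans
    (Nat.geomSum_lt hq (n := d / 2 + 1) (by simp)).le
  refine (Multiset.toFinset_card_le _).trans ((card_roots' _).trans ?_)
  rw [FiniteField.X_pow_card_pow_sub_X_natDegree_eq K (by simp at hj; omega) hq]

open Classical in
/-- An irreducible polynomial whose degree is that of the extension splits there with distinct
roots. -/
theorem card_filter_minpoly_eq [Fintype K] {f : F[X]} (hf : f.Monic) (hi : Irreducible f)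
    (hd : f.natDegree = Module.finrank F K) :
    (Finset.univ.filter fun α : K => minpoly F α = f).card = f.natDegree := by
  have : Module.Finite F K := Module.Finite.of_finite
  have hK : Nat.card K = Nat.card F ^ Module.finrank F K := Module.natCard_eq_pow_finrank
  have hdvd : f ∣ X ^ Nat.card F ^ Module.finrank F K - X :=
    hi.natDegree_dvd_iff_dvd_X_pow_card_pow_sub_X.1 hd.dvd
  have hsplit : (f.map (algebraMap F K)).Splits := by
    refine Splits.of_dvd ?_ ?_ (map_dvd (mapRingHom (algebraMap F K)) hdvd)
    · have : (mapRingHom (algebraMap F K)) (X ^ Nat.card F ^ Module.finrank F K - X) =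
          X ^ Fintype.card K - X := by
        rw [← hK, ← Nat.card_eq_fintype_card]; simp
      rw [this]
      rw [splits_iff_card_roots, FiniteField.roots_X_pow_card_sub_X,
        FiniteField.X_pow_card_sub_X_natDegree_eq K Fintype.one_lt_card]
      rfl
    · have := FiniteField.X_pow_card_pow_sub_X_ne_zero K (n := Module.finrank F K)
        Module.finrank_pos.ne' (p := Nat.card F) Finite.one_lt_card
      simpa using this
  have hsep : f.Separable := PerfectField.separable_of_irreducible hi
  rw [← card_rootSet_eq_natDegree (K := K) hsep hsplit, ← Fintype.card_coe]
  refine Fintype.card_congr (Equiv.subtypeEquivRight fun α => ?_)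
  simp only [Finset.mem_filter, Finset.mem_univ, true_and, mem_rootSet, hf.ne_zero, ne_eq,
    not_false_eq_true]
  constructor
  · rintro rfl; exact minpoly.aeval _ _
  · intro h; exact (minpoly.eq_of_irreducible_of_monic hi h hf).symm

end Extension

/-- Equidistribution of the monic irreducible polynomials of degree `d` over the nonzero constant
terms, with an error of square-root size. Their roots in the extension of degree `d` are the
generators of prescribed norm; the norm is equidistributed, and few elements are not generators. -/
theorem exists_card_primesWithConst_bounds (F : Type*) [Field F] [Finite F] {d : ℕ} (hd : d ≠ 0) :
    ∃ m : ℕ, m * (Nat.card F - 1) = Nat.card F ^ d - 1 ∧ ∀ e : F, e ≠ 0 →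
      d * (primesWithConst d e).card ≤ m ∧
        m ≤ d * (primesWithConst d e).card + Nat.card F ^ (d / 2 + 1) := by
  classical
  obtain ⟨p, hp⟩ := CharP.exists F
  have : Fact p.Prime := ⟨CharP.char_is_prime F p⟩
  have : NeZero d := ⟨hd⟩
  let K := FiniteField.Extension F p d
  have := Fintype.ofFinite K
  have hrank : Module.finrank F K = d := FiniteField.finrank_extension F p d
  have hcard : Nat.card K = Nat.card F ^ d := FiniteField.natCard_extension F p d
  obtain ⟨m, hm, hU⟩ := exists_ncard_norm_eq (F := F) (K := K)
  refine ⟨m, by rw [hm, hcard], fun e he => ?_⟩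
  -- each such irreducible polynomial is the minimal polynomial of exactly `d` elements of `K`
  have hgood : {α : K | (minpoly F α).natDegree = d ∧ (minpoly F α).coeff 0 = e}.ncard =
      d * (primesWithConst d e).card := by
    have h1 : {α : K | (minpoly F α).natDegree = d ∧ (minpoly F α).coeff 0 = e}.ncard =
      (Finset.univ.filter fun α : K => (minpoly F α).natDegree = d ∧
        (minpoly F α).coeff 0 = e).card := by
      rw [← Set.ncard_coe_finset]; simp
    rw [h1, Finset.card_eq_sum_card_fiberwise (f := fun α => minpoly F α)
      (t := primesWithConst d e), Finset.sum_congr rfl (g := fun _ => d), Finset.sum_const,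
      smul_eq_mul, mul_comm]
    · intro f hf
      rw [mem_primesWithConst] at hf
      refine Eq.trans ?_ ((card_filter_minpoly_eq (K := K) hf.1.1 hf.2.1
        (hf.1.2.trans hrank.symm)).trans hf.1.2)
      congr 1
      ext α
      simp only [Finset.mem_filter, Finset.mem_univ, true_and, and_iff_right_iff_imp]
      rintro rfl
      exact ⟨by rw [hf.1.2], hf.2.2⟩
    · intro α hα
      have hint : IsIntegral F α := Algebra.IsIntegral.isIntegral α
      simp only [Finset.coe_filter, Finset.mem_univ, true_and, Set.mem_ofPred_eq] at hα
      exact mem_primesWithConst.2 ⟨⟨minpoly.monic hint, hα.1⟩, minpoly.irreducible hint, hα.2⟩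
  have hsign : ((-1 : F) ^ d) ≠ 0 := by simp
  have hbad := ncard_natDegree_minpoly_ne_le (F := F) (K := K)
  rw [hrank] at hbad
  rw [← hgood, ← hU ((-1) ^ d * e) (mul_ne_zero hsign he)]
  have hnorm : ∀ α : K, (minpoly F α).natDegree = d →
      (Algebra.norm F α = (-1) ^ d * e ↔ (minpoly F α).coeff 0 = e) := by
    intro α hα
    rw [norm_eq_coeff_zero_minpoly_of_natDegree_eq (hα.trans hrank.symm), hrank]
    exact (mul_right_injective₀ hsign).eq_iff
  constructor
  · exact Set.ncard_le_ncard (fun α hα => (hnorm α hα.1).2 hα.2) (Set.toFinite _)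
  · refine (Set.ncard_le_ncard (t := _ ∪ _) (fun α hα => ?_) (Set.toFinite _)).trans
      ((Set.ncard_union_le _ _).trans (Nat.add_le_add_left hbad _))
    by_cases h : (minpoly F α).natDegree = d
    · exact Or.inl ⟨h, (hnorm α h).1 hα⟩
    · exact Or.inr h

end Primes

/-! ### Weights of squarefree polynomials and their recursion -/

section Weights

variable {F : Type*} [Field F]

/-- The reciprocal of the order of the unit group of `F[X]/(f)`. For squarefree `f` with `f(0) ≠ 0`
this is the probability that a uniformly random element of `GL` has characteristic polynomial
`f`. -/
noncomputable def classWeight (f : F[X]) : ℝ := (Nat.card (AdjoinRoot f)ˣ : ℝ)⁻¹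

theorem classWeight_nonneg (f : F[X]) : 0 ≤ classWeight f := by
  unfold classWeight; positivity

/-- Multiplicativity of the class weight, from the Chinese remainder theorem. -/
theorem classWeight_mul {f g : F[X]} (h : IsCoprime f g) :
    classWeight (f * g) = classWeight f * classWeight g := by
  have e : AdjoinRoot (f * g) ≃+* AdjoinRoot f × AdjoinRoot g :=
    (Ideal.quotEquivOfEq (Ideal.span_singleton_mul_span_singleton f g).symm).trans
      (Ideal.quotientMulEquivQuotientProd _ _ ((Ideal.isCoprime_span_singleton_iff f g).2 h))
  have hc := Nat.card_congr
    ((Units.mapEquiv e.toMulEquiv).trans MulEquiv.prodUnits).toEquiv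
  rw [Nat.card_prod] at hc
  unfold classWeight
  rw [hc, Nat.cast_mul, mul_inv]

theorem classWeight_of_irreducible [Finite F] {f : F[X]} (hf : Irreducible f) :
    classWeight f = ((Nat.card F : ℝ) ^ f.natDegree - 1)⁻¹ := by
  have : Fact (Irreducible f) := ⟨hf⟩
  have : Module.Finite F (AdjoinRoot f) := (AdjoinRoot.powerBasis hf.ne_zero).finite
  have hrank : Module.finrank F (AdjoinRoot f) = f.natDegree :=
    (AdjoinRoot.powerBasis hf.ne_zero).finrank
  unfold classWeight
  rw [Nat.card_units, Module.natCard_eq_pow_finrank (K := F), hrank,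
    Nat.cast_sub (Nat.one_le_pow _ _ Nat.card_pos)]
  simp

variable [Finite F]

open Classical in
/-- The characteristic polynomials of the regular semisimple elements of `GL n`: the squarefree
monic polynomials of degree `n` with nonzero constant term. -/
noncomputable def rsPolys (F : Type*) [Field F] [Finite F] (n : ℕ) : Finset F[X] :=
  (monicsOfDegree F n).filter fun f => Squarefree f ∧ f.coeff 0 ≠ 0

theorem mem_rsPolys {n : ℕ} {f : F[X]} :
    f ∈ rsPolys F n ↔ (f.Monic ∧ f.natDegree = n) ∧ Squarefree f ∧ f.coeff 0 ≠ 0 := by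
  simp [rsPolys]

open Classical in
/-- Total class weight of the squarefree polynomials of degree `n` with constant term `c`. -/
noncomputable def rsWeight (n : ℕ) (c : F) : ℝ :=
  ∑ f ∈ rsPolys F n with f.coeff 0 = c, classWeight f

/-- Total class weight of all squarefree polynomials of degree `n` with nonzero constant term. -/
noncomputable def rsTotalWeight (F : Type*) [Field F] [Finite F] (n : ℕ) : ℝ :=
  ∑ f ∈ rsPolys F n, classWeight f

open Classical in
/-- Total class weight of the multiples of `φ` among the squarefree polynomials of degree `n` with
constant term `c`. -/
noncomputable def rsWeightMultiples (n : ℕ) (c : F) (φ : F[X]) : ℝ :=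
  ∑ f ∈ rsPolys F n with f.coeff 0 = c ∧ φ ∣ f, classWeight f

theorem rsWeight_nonneg (n : ℕ) (c : F) : 0 ≤ rsWeight n c :=
  Finset.sum_nonneg fun _ _ => classWeight_nonneg _

theorem rsWeightMultiples_nonneg (n : ℕ) (c : F) (φ : F[X]) : 0 ≤ rsWeightMultiples n c φ :=
  Finset.sum_nonneg fun _ _ => classWeight_nonneg _

theorem natCard_minpoly_eq_charpoly_eq {n : ℕ} {f : F[X]} (hf : f ∈ rsPolys F n) :
    (Nat.card {g : GL (Fin n) F // minpoly F (g : Matrix (Fin n) (Fin n) F) = f ∧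
        (g : Matrix (Fin n) (Fin n) F).charpoly = f} : ℝ) =
      Nat.card (GL (Fin n) F) * classWeight f := by
  obtain ⟨⟨h1, h2⟩, h3, h4⟩ := mem_rsPolys.1 hf
  have h := natCard_minpoly_eq_charpoly_eq_mul h1 h3 h2 h4
  have hne : (Nat.card (AdjoinRoot f)ˣ : ℝ) ≠ 0 := by
    intro h0
    rw [Nat.cast_eq_zero] at h0
    rw [h0, mul_zero] at h
    exact Nat.card_pos.ne h
  unfold classWeight
  rw [← h, Nat.cast_mul, mul_assoc, mul_inv_cancel₀ hne, mul_one]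

open Classical in
/-- Summing the class sizes over a set of characteristic polynomials. -/
theorem natCard_charpoly_mem {n : ℕ} {s : Finset F[X]} (hs : s ⊆ rsPolys F n) :
    ({g : GL (Fin n) F | minpoly F (g : Matrix (Fin n) (Fin n) F) =
        (g : Matrix (Fin n) (Fin n) F).charpoly ∧
          (g : Matrix (Fin n) (Fin n) F).charpoly ∈ s}.ncard : ℝ) =
      Nat.card (GL (Fin n) F) * ∑ f ∈ s, classWeight f := by
  have := Fintype.ofFinite F
  rw [Finset.mul_sum, ← Finset.sum_congr rfl fun f hf => natCard_minpoly_eq_charpoly_eq (hs hf),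
    ← Nat.cast_sum, Nat.cast_inj]
  have h1 : {g : GL (Fin n) F | minpoly F (g : Matrix (Fin n) (Fin n) F) =
        (g : Matrix (Fin n) (Fin n) F).charpoly ∧
          (g : Matrix (Fin n) (Fin n) F).charpoly ∈ s}.ncard =
      (Finset.univ.filter fun g : GL (Fin n) F => minpoly F (g : Matrix (Fin n) (Fin n) F) =
        (g : Matrix (Fin n) (Fin n) F).charpoly ∧
          (g : Matrix (Fin n) (Fin n) F).charpoly ∈ s).card := by
    rw [← Set.ncard_coe_finset]; simp
  rw [h1, Finset.card_eq_sum_card_fiberwise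
    (f := fun g : GL (Fin n) F => (g : Matrix (Fin n) (Fin n) F).charpoly) (t := s)]
  · refine Finset.sum_congr rfl fun f hf => ?_
    rw [Nat.card_eq_fintype_card, Fintype.card_subtype]
    congr 1
    ext g
    simp only [Finset.mem_filter, Finset.mem_univ, true_and]
    constructor
    · rintro ⟨⟨h1, -⟩, h2⟩; exact ⟨h1.trans h2, h2⟩
    · rintro ⟨h1, h2⟩; exact ⟨⟨h1.trans h2.symm, h2 ▸ hf⟩, h2⟩
  · intro g hg
    simp at hg
    exact hg.2

/-- The total weight is the proportion of regular semisimple elements in `GL n`. -/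
theorem rsTotalWeight_le_one (n : ℕ) : rsTotalWeight F n ≤ 1 := by
  have h := natCard_charpoly_mem (F := F) (n := n) (subset_refl _)
  have hpos : (0 : ℝ) < Nat.card (GL (Fin n) F) := Nat.cast_pos.2 Nat.card_pos
  refine le_of_mul_le_mul_left ?_ hpos
  rw [mul_one, rsTotalWeight, ← h, Nat.cast_le]
  exact Set.ncard_le_card _

open Classical in
theorem sum_rsWeight [Fintype F] (n : ℕ) :
    ∑ c ∈ Finset.univ.erase (0 : F), rsWeight n c = rsTotalWeight F n :=
  Finset.sum_fiberwise_of_maps_to (fun f hf => by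
    simpa using (mem_rsPolys.1 hf).2.2) _

open Classical in
theorem sum_rsWeight_div [Fintype F] (n : ℕ) {c : F} (hc : c ≠ 0) :
    ∑ e ∈ Finset.univ.erase (0 : F), rsWeight n (c / e) = rsTotalWeight F n := by
  rw [← sum_rsWeight n]
  refine Finset.sum_nbij' (fun e => c / e) (fun e => c / e) ?_ ?_ ?_ ?_ ?_
  · intro e he; simp at he ⊢; exact ⟨hc, he⟩
  · intro e he; simp at he ⊢; exact ⟨hc, he⟩
  · intro e he; exact div_div_cancel₀ hc
  · intro e he; exact div_div_cancel₀ hc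
  · intro e he; rfl

open Classical in
theorem rsWeight_sub_rsWeightMultiples (n : ℕ) (c : F) (φ : F[X]) :
    rsWeight n c - rsWeightMultiples n c φ =
      ∑ f ∈ rsPolys F n with f.coeff 0 = c ∧ ¬ φ ∣ f, classWeight f := by
  rw [sub_eq_iff_eq_add', rsWeight, rsWeightMultiples, ← Finset.filter_filter,
    ← Finset.filter_filter, Finset.sum_filter_add_sum_filter_not]

/-- A squarefree multiple of the prime `φ` is uniquely `φ * g` with `g` squarefree and prime
to `φ`. -/
theorem rsWeightMultiples_add {d k : ℕ} {c e : F} (he : e ≠ 0) {φ : F[X]}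
    (hφ : φ ∈ primesWithConst d e) :
    rsWeightMultiples (d + k) c φ = ((Nat.card F : ℝ) ^ d - 1)⁻¹ *
      (rsWeight k (c / e) - rsWeightMultiples k (c / e) φ) := by
  classical
  obtain ⟨⟨hm, hd⟩, hi, hc0⟩ := mem_primesWithConst.1 hφ
  rw [rsWeight_sub_rsWeightMultiples, Finset.mul_sum, rsWeightMultiples]
  symm
  refine Finset.sum_bij (fun g _ => φ * g) ?_ ?_ ?_ ?_
  · intro g hg
    simp only [Finset.mem_filter, mem_rsPolys] at hg ⊢
    obtain ⟨⟨⟨h1, h2⟩, h3, h4⟩, h5, h6⟩ := hg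
    refine ⟨⟨⟨hm.mul h1, by rw [hm.natDegree_mul h1, hd, h2]⟩, ?_, ?_⟩, ?_, dvd_mul_right _ _⟩
    · exact squarefree_mul_iff.2 ⟨((hi.coprime_iff_not_dvd).2 h6).isRelPrime, hi.squarefree, h3⟩
    · rw [mul_coeff_zero, hc0]; exact mul_ne_zero he h4
    · rw [mul_coeff_zero, hc0, h5, mul_div_cancel₀ _ he]
  · intro g _ g' _ h
    exact mul_left_cancel₀ hi.ne_zero h
  · intro f hf
    simp only [Finset.mem_filter, mem_rsPolys] at hf
    obtain ⟨⟨⟨h1, h2⟩, h3, h4⟩, h5, g, rfl⟩ := hf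
    have hg : g.Monic := hm.of_mul_monic_left h1
    rw [hm.natDegree_mul hg, hd] at h2
    rw [mul_coeff_zero, hc0] at h4 h5
    refine ⟨g, ?_, rfl⟩
    simp only [Finset.mem_filter, mem_rsPolys]
    refine ⟨⟨⟨hg, by omega⟩, h3.of_mul_right, right_ne_zero_of_mul h4⟩, ?_, ?_⟩
    · rw [← h5, mul_div_cancel_left₀ _ he]
    · intro h
      exact hi.not_isUnit (h3 φ (mul_dvd_mul_left φ h))
  · intro g hg
    simp only [Finset.mem_filter] at hg
    rw [classWeight_mul ((hi.coprime_iff_not_dvd).2 hg.2.2), classWeight_of_irreducible hi, hd]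

theorem rsWeightMultiples_zero_of_lt {n : ℕ} {c : F} {φ : F[X]} (h : n < φ.natDegree) :
    rsWeightMultiples n c φ = 0 := by
  classical
  refine Finset.sum_eq_zero fun f hf => ?_
  simp only [Finset.mem_filter, mem_rsPolys] at hf
  exact absurd (natDegree_le_of_dvd hf.2.2 hf.1.1.1.ne_zero) (by omega)

open Classical in
/-- The degree of a squarefree polynomial is the sum of the degrees of its prime factors. -/
theorem natDegree_eq_sum_primes [Fintype F] {n : ℕ} {f : F[X]} (hf : f ∈ rsPolys F n) :
    (n : ℝ) = ∑ d ∈ Finset.Icc 1 n, ∑ e ∈ Finset.univ.erase (0 : F),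
      ∑ φ ∈ primesWithConst d e, if φ ∣ f then (d : ℝ) else 0 := by
  obtain ⟨⟨hm, hn⟩, hsq, h0⟩ := mem_rsPolys.1 hf
  have hne := hm.ne_zero
  set s := (UniqueFactorizationMonoid.normalizedFactors f).toFinset with hs
  have hnodup : (UniqueFactorizationMonoid.normalizedFactors f).Nodup :=
    (UniqueFactorizationMonoid.squarefree_iff_nodup_normalizedFactors hne).1 hsq
  have hmem : ∀ φ, φ ∈ s ↔ φ.Monic ∧ Irreducible φ ∧ φ ∣ f := by
    intro φ
    rw [hs, Multiset.mem_toFinset, Polynomial.mem_normalizedFactors_iff hne]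
    tauto
  have hsum : n = ∑ φ ∈ s, φ.natDegree := by
    have h1 : (UniqueFactorizationMonoid.normalizedFactors f).prod = f := by
      have := UniqueFactorizationMonoid.prod_normalizedFactors_eq hne
      rw [this, hm.normalize_eq_self]
    have h2 : ∏ φ ∈ s, φ = f := by
      rw [hs, Finset.prod, Multiset.toFinset_val, hnodup.dedup, Multiset.map_id']
      exact h1
    rw [← hn]
    conv_lhs => rw [← h2]
    exact natDegree_prod_of_monic _ _ fun φ hφ => ((hmem φ).1 hφ).1
  have hmaps : ∀ φ ∈ s, (φ.natDegree, φ.coeff 0) ∈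
      Finset.Icc 1 n ×ˢ Finset.univ.erase (0 : F) := by
    intro φ hφ
    obtain ⟨h1, h2, h3⟩ := (hmem φ).1 hφ
    simp only [Finset.mem_product, Finset.mem_Icc, Finset.mem_erase, Finset.mem_univ, and_true]
    refine ⟨⟨h2.natDegree_pos, hn ▸ natDegree_le_of_dvd h3 hne⟩, ?_⟩
    obtain ⟨g, rfl⟩ := h3
    rw [mul_coeff_zero] at h0
    exact left_ne_zero_of_mul h0
  rw [← Finset.sum_product', hsum, Nat.cast_sum, ← Finset.sum_fiberwise_of_maps_to hmaps]
  refine Finset.sum_congr (by rw [← hsum]) ?_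
  rintro ⟨d, e⟩ -
  rw [← Finset.sum_filter]
  refine Finset.sum_congr ?_ ?_
  · ext φ
    simp only [Finset.mem_filter, hmem, mem_primesWithConst, Prod.mk.injEq]
    tauto
  · intro φ hφ
    simp only [Finset.mem_filter, mem_primesWithConst] at hφ
    rw [hφ.1.1.2]

open Classical in
/-- Weighting each polynomial by its degree, written as the sum of the degrees of its prime factors,
and exchanging the sums. -/
theorem mul_rsWeight_eq_sum [Fintype F] (n : ℕ) (c : F) :
    n * rsWeight n c = ∑ d ∈ Finset.Icc 1 n, ∑ e ∈ Finset.univ.erase (0 : F),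
      ∑ φ ∈ primesWithConst d e, d * rsWeightMultiples n c φ := by
  rw [rsWeight, Finset.mul_sum, Finset.sum_congr rfl (g := fun f => ∑ d ∈ Finset.Icc 1 n,
    ∑ e ∈ Finset.univ.erase (0 : F), ∑ φ ∈ primesWithConst d e,
      if φ ∣ f then (d : ℝ) * classWeight f else 0), Finset.sum_comm]
  · refine Finset.sum_congr rfl fun d _ => ?_
    rw [Finset.sum_comm]
    refine Finset.sum_congr rfl fun e _ => ?_
    rw [Finset.sum_comm]
    refine Finset.sum_congr rfl fun φ _ => ?_
    rw [rsWeightMultiples, Finset.mul_sum, ← Finset.filter_filter, ← Finset.sum_filter]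
  · intro f hf
    rw [natDegree_eq_sum_primes (Finset.mem_filter.1 hf).1]
    simp only [Finset.sum_mul, ite_mul, zero_mul]

theorem rsWeightMultiples_le {n d : ℕ} {c e : F} (hd : d ≠ 0) (he : e ≠ 0) (hc : c ≠ 0) {φ : F[X]}
    (hφ : φ ∈ primesWithConst d e) :
    rsWeightMultiples n c φ ≤ ((Nat.card F : ℝ) ^ d - 1)⁻¹ := by
  classical
  have := Fintype.ofFinite F
  have hq : (1 : ℝ) < Nat.card F := by exact_mod_cast Finite.one_lt_card (α := F)
  have hqd : 0 < (Nat.card F : ℝ) ^ d - 1 := sub_pos.2 (one_lt_pow₀ hq hd)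
  rcases lt_or_ge n d with h | h
  · rw [rsWeightMultiples_zero_of_lt (by rwa [(mem_primesWithConst.1 hφ).1.2])]
    positivity
  · obtain ⟨k, rfl⟩ := Nat.exists_eq_add_of_le h
    rw [rsWeightMultiples_add he hφ]
    refine mul_le_of_le_one_right (by positivity) ?_
    refine (sub_le_self _ (rsWeightMultiples_nonneg _ _ _)).trans ?_
    refine le_trans ?_ (rsTotalWeight_le_one (F := F) k)
    rw [← sum_rsWeight]
    exact Finset.single_le_sum (f := fun c => rsWeight k c) (fun _ _ => rsWeight_nonneg _ _)
      (by simp [hc, he])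

open Classical in
/-- The contribution of the primes of degree `d` to the recursion for `rsWeight` hardly depends on
the constant term `c`: were the primes of degree `d` exactly equidistributed over the constant terms,
and none of them repeated in a product, it would be `rsTotalWeight F k / (q - 1)`. -/
theorem sum_primes_bounds [Fintype F] {d : ℕ} (hd : d ≠ 0) (k : ℕ) {c : F} (hc : c ≠ 0) :
    (∑ e ∈ Finset.univ.erase (0 : F), ∑ φ ∈ primesWithConst d e,
        d * rsWeightMultiples (d + k) c φ) ≤ rsTotalWeight F k / (Nat.card F - 1) ∧
    rsTotalWeight F k / (Nat.card F - 1) -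
        ((Nat.card F : ℝ) ^ (d / 2 + 1) + 1) / ((Nat.card F : ℝ) ^ d - 1) ≤
      ∑ e ∈ Finset.univ.erase (0 : F), ∑ φ ∈ primesWithConst d e,
        d * rsWeightMultiples (d + k) c φ := by
  obtain ⟨m, hm, hbd⟩ := exists_card_primesWithConst_bounds F hd
  have hq1 : 1 < Nat.card F := Finite.one_lt_card
  have hE : ((Finset.univ.erase (0 : F)).card : ℝ) = Nat.card F - 1 := by
    rw [Finset.card_erase_of_mem (Finset.mem_univ _), Finset.card_univ, ← Nat.card_eq_fintype_card,
      Nat.cast_sub hq1.le, Nat.cast_one]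
  have hmR : (m : ℝ) * (Nat.card F - 1) = (Nat.card F : ℝ) ^ d - 1 := by
    rw [← Nat.cast_pow, ← Nat.cast_one, ← Nat.cast_sub hq1.le,
      ← Nat.cast_sub (Nat.one_le_pow d _ Nat.card_pos), ← Nat.cast_mul, hm]
  have hbdR : ∀ e : F, e ≠ 0 → (d : ℝ) * (primesWithConst d e).card ≤ m ∧
      (m : ℝ) ≤ d * (primesWithConst d e).card + (Nat.card F : ℝ) ^ (d / 2 + 1) := fun e he => by
    exact_mod_cast hbd e he
  have hq : (1 : ℝ) < Nat.card F := by exact_mod_cast hq1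
  set q : ℝ := (Nat.card F : ℝ)
  have hQ : 0 < q ^ d - 1 := sub_pos.2 (one_lt_pow₀ hq hd)
  set Q : ℝ := q ^ d - 1
  have hq0 : 0 < q - 1 := sub_pos.2 hq
  -- the main term, from `∑ e, rsWeight k (c / e) = rsTotalWeight F k`
  have hmain : m * Q⁻¹ * rsTotalWeight F k = rsTotalWeight F k / (q - 1) := by
    rw [← hmR]
    have : (m : ℝ) ≠ 0 := by
      intro h; rw [h, zero_mul] at hmR; exact hQ.ne hmR
    field_simp
  constructor
  · rw [← hmain, ← sum_rsWeight_div k hc, Finset.mul_sum]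
    refine Finset.sum_le_sum fun e he => ?_
    have he0 := Finset.ne_of_mem_erase he
    have hA := rsWeight_nonneg k (c / e)
    calc ∑ φ ∈ primesWithConst d e, d * rsWeightMultiples (d + k) c φ
        ≤ ∑ φ ∈ primesWithConst d e, (d : ℝ) * (Q⁻¹ * rsWeight k (c / e)) := by
          refine Finset.sum_le_sum fun φ hφ => ?_
          rw [rsWeightMultiples_add he0 hφ]
          have := rsWeightMultiples_nonneg k (c / e) φ
          gcongr
          linarith
      _ = d * (primesWithConst d e).card * (Q⁻¹ * rsWeight k (c / e)) := by
          rw [Finset.sum_const, nsmul_eq_mul]; ring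
      _ ≤ m * (Q⁻¹ * rsWeight k (c / e)) := by
          gcongr
          exact (hbdR e he0).1
      _ = m * Q⁻¹ * rsWeight k (c / e) := by ring
  · have hone := rsTotalWeight_le_one (F := F) k
    have hterm : ∀ e ∈ Finset.univ.erase (0 : F),
        (m - q ^ (d / 2 + 1)) * Q⁻¹ * rsWeight k (c / e) - m * Q⁻¹ * Q⁻¹ ≤
          ∑ φ ∈ primesWithConst d e, d * rsWeightMultiples (d + k) c φ := by
      intro e he
      have he0 := Finset.ne_of_mem_erase he
      have hA := rsWeight_nonneg k (c / e)
      have h1 : (m - q ^ (d / 2 + 1)) * (Q⁻¹ * rsWeight k (c / e)) ≤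
          d * (primesWithConst d e).card * (Q⁻¹ * rsWeight k (c / e)) := by
        gcongr
        linarith [(hbdR e he0).2]
      have h2 : d * (primesWithConst d e).card * (Q⁻¹ * Q⁻¹) ≤ m * (Q⁻¹ * Q⁻¹) := by
        gcongr
        exact (hbdR e he0).1
      calc (m - q ^ (d / 2 + 1)) * Q⁻¹ * rsWeight k (c / e) - m * Q⁻¹ * Q⁻¹
          ≤ d * (primesWithConst d e).card * (Q⁻¹ * (rsWeight k (c / e) - Q⁻¹)) := by
            linarith
        _ = ∑ φ ∈ primesWithConst d e, (d : ℝ) * (Q⁻¹ * (rsWeight k (c / e) - Q⁻¹)) := by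
            rw [Finset.sum_const, nsmul_eq_mul]; ring
        _ ≤ _ := by
            refine Finset.sum_le_sum fun φ hφ => ?_
            rw [rsWeightMultiples_add he0 hφ]
            have := rsWeightMultiples_le (n := k) hd he0 (div_ne_zero hc he0) hφ
            gcongr
    refine le_trans ?_ (Finset.sum_le_sum hterm)
    rw [Finset.sum_sub_distrib, ← Finset.mul_sum, sum_rsWeight_div k hc, Finset.sum_const,
      nsmul_eq_mul, hE, sub_mul, sub_mul, hmain]
    have h3 : (q - 1) * (m * Q⁻¹ * Q⁻¹) = Q⁻¹ := by
      rw [← mul_assoc, ← mul_assoc, mul_comm (q - 1), hmR, mul_inv_cancel₀ hQ.ne', one_mul]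
    have h4 : q ^ (d / 2 + 1) * Q⁻¹ * rsTotalWeight F k ≤ q ^ (d / 2 + 1) * Q⁻¹ :=
      mul_le_of_le_one_right (by positivity) hone
    rw [h3, add_div, div_eq_mul_inv (q ^ (d / 2 + 1)), one_div]
    linarith

end Weights

/-- The errors in `sum_primes_bounds` are summable: they are `O(q * √q ^ (-d))`. -/
theorem exists_sum_error_le {q : ℝ} (hq : 2 ≤ q) : ∃ C : ℝ, ∀ n : ℕ,
    ∑ d ∈ Finset.Icc 1 n, (q ^ (d / 2 + 1) + 1) / (q ^ d - 1) ≤ C := by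
  have hs1 : 1 < √q := by
    rw [Real.lt_sqrt zero_le_one]; linarith
  have hs : √q ^ 2 = q := Real.sq_sqrt (by linarith)
  have hsum : Summable fun d : ℕ => 4 * q * (√q)⁻¹ ^ d :=
    (summable_geometric_of_lt_one (by positivity) (inv_lt_one_of_one_lt₀ hs1)).mul_left _
  refine ⟨∑' d : ℕ, 4 * q * (√q)⁻¹ ^ d, fun n => ?_⟩
  refine (Finset.sum_le_sum fun d hd => ?_).trans
    (hsum.sum_le_tsum (Finset.Icc 1 n) fun d _ => by positivity)
  have hd1 : 1 ≤ d := (Finset.mem_Icc.1 hd).1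
  have h2 : 2 ≤ q ^ d := hq.trans (le_self_pow₀ (by linarith) (by omega))
  have h3 : q ^ (d / 2) ≤ √q ^ d := by
    conv_lhs => rw [← hs, ← pow_mul]
    exact pow_le_pow_right₀ hs1.le (Nat.mul_div_le d 2)
  have h4 : q ^ d = √q ^ d * √q ^ d := by
    conv_lhs => rw [← hs, ← pow_mul, mul_comm, pow_mul, sq]
  have h5 : 0 < √q ^ d := by positivity
  have h6 : 1 ≤ q * √q ^ d := by nlinarith [one_le_pow₀ hs1.le (n := d)]
  rw [div_le_iff₀ (by linarith), inv_pow]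
  calc q ^ (d / 2 + 1) + 1 ≤ q * √q ^ d + q * √q ^ d := by
        rw [pow_succ, mul_comm]; gcongr
    _ = 4 * q * (√q ^ d)⁻¹ * (q ^ d / 2) := by
        rw [h4]; field_simp; ring
    _ ≤ _ := by gcongr; linarith

/-- The weight of squarefree polynomials of degree `n` with a given constant term is independent of
that constant term up to `O(1 / n)`: both sides of the recursion `mul_rsWeight_eq_sum` are within a
bounded distance of the same quantity. -/
theorem exists_abs_rsWeight_sub_le {q : ℕ} (hq : 2 ≤ q) : ∃ C : ℝ, ∀ (F : Type*) [Field F]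
    [Finite F], Nat.card F = q → ∀ (n : ℕ) (c c' : F), c ≠ 0 → c' ≠ 0 →
      n * |rsWeight n c - rsWeight n c'| ≤ C := by
  classical
  obtain ⟨C, hC⟩ := exists_sum_error_le (q := q) (by exact_mod_cast hq)
  refine ⟨C, fun F _ _ hF n c c' hc hc' => ?_⟩
  have := Fintype.ofFinite F
  -- the sum below does not involve `c`
  have key : ∀ c : F, c ≠ 0 →
      n * rsWeight n c ≤ ∑ d ∈ Finset.Icc 1 n, rsTotalWeight F (n - d) / (q - 1) ∧
      (∑ d ∈ Finset.Icc 1 n, rsTotalWeight F (n - d) / (q - 1)) - C ≤ n * rsWeight n c := by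
    intro c hc
    have hb : ∀ d ∈ Finset.Icc 1 n, _ := fun d hd =>
      sum_primes_bounds (F := F) (Nat.one_le_iff_ne_zero.1 (Finset.mem_Icc.1 hd).1) (n - d) hc
    rw [mul_rsWeight_eq_sum]
    constructor
    · refine Finset.sum_le_sum fun d hd => ?_
      have := (hb d hd).1
      rwa [Nat.add_sub_cancel' (Finset.mem_Icc.1 hd).2, hF] at this
    · refine (sub_le_sub_left (hC n) _).trans ?_
      rw [← Finset.sum_sub_distrib]
      refine Finset.sum_le_sum fun d hd => ?_
      have := (hb d hd).2
      rwa [Nat.add_sub_cancel' (Finset.mem_Icc.1 hd).2, hF] at this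
  have h1 := key c hc
  have h2 := key c' hc'
  nth_rewrite 1 [← Nat.abs_cast n]
  rw [← abs_mul, abs_le, mul_sub]
  constructor <;> linarith

/-! ### Cosets of subgroups containing the special linear group -/

section Cosets

variable {F : Type*} [Field F] {n : ℕ}

theorem det_eq_iff_charpoly_coeff_zero_eq (g : GL (Fin n) F) (δ : Fˣ) :
    Matrix.GeneralLinearGroup.det g = δ ↔
      (g : Matrix (Fin n) (Fin n) F).charpoly.coeff 0 = (-1) ^ n * (δ : F) := by
  have hsq : ((-1 : F) ^ n) * (-1) ^ n = 1 := by rw [← mul_pow]; simp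
  rw [Units.ext_iff, Matrix.GeneralLinearGroup.val_det_apply, Matrix.det_eq_sign_charpoly_coeff,
    Fintype.card_fin]
  constructor
  · intro h
    rw [← h, ← mul_assoc, hsq, one_mul]
  · intro h
    rw [h, ← mul_assoc, hsq, one_mul]

theorem ncard_isRegularSemisimpleGL_det_eq [Finite F] (δ : Fˣ) :
    ({g : GL (Fin n) F | IsRegularSemisimpleGL g ∧
        Matrix.GeneralLinearGroup.det g = δ}.ncard : ℝ) =
      Nat.card (GL (Fin n) F) * rsWeight n ((-1) ^ n * (δ : F)) := by
  classical
  rw [rsWeight, ← natCard_charpoly_mem (Finset.filter_subset _ _)]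
  congr 2
  ext g
  simp only [Set.mem_ofPred_eq, isRegularSemisimpleGL_iff, det_eq_iff_charpoly_coeff_zero_eq,
    Finset.mem_filter, mem_rsPolys]
  constructor
  · rintro ⟨⟨h1, h2⟩, h3⟩
    refine ⟨h1, ⟨⟨Matrix.charpoly_monic _, ?_⟩, h2, ?_⟩, h3⟩
    · rw [Matrix.charpoly_natDegree_eq_dim, Fintype.card_fin]
    · rw [h3]; simp
  · rintro ⟨h1, ⟨-, h2, -⟩, h3⟩
    exact ⟨⟨h1, h2⟩, h3⟩

/-- A coset of a subgroup containing `SL n` is a union of fibres of the determinant. -/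
theorem mem_coset_of_det_eq {H : Subgroup (GL (Fin n) F)} (hH : slSubgroup n F ≤ H)
    {a g g' : GL (Fin n) F} (hg : g ∈ a • (H : Set (GL (Fin n) F)))
    (h : Matrix.GeneralLinearGroup.det g' = Matrix.GeneralLinearGroup.det g) :
    g' ∈ a • (H : Set (GL (Fin n) F)) := by
  rw [Set.mem_smul_set_iff_inv_smul_mem] at hg ⊢
  have hdet : Matrix.GeneralLinearGroup.det (g⁻¹ * g') = 1 := by
    rw [map_mul, map_inv, h, inv_mul_cancel]
  have h1 : g⁻¹ * g' ∈ H := by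
    refine hH ⟨⟨((g⁻¹ * g' : GL (Fin n) F) : Matrix (Fin n) (Fin n) F), ?_⟩, ?_⟩
    · simpa using congrArg Units.val hdet
    · exact Units.ext rfl
  have h2 : a⁻¹ • g' = (a⁻¹ • g) * (g⁻¹ * g') := by
    simp [smul_eq_mul, mul_assoc]
  rw [h2]
  exact H.mul_mem hg h1

/-- The proportion of regular semisimple elements in a coset is an average of `rsWeight`, up to a
bounded factor: the average runs over the determinants `δ` of the elements of the coset, and `κ` is
the number of values of the determinant on `GL n`. -/
theorem exists_rsProportion_coset_eq [Finite F] : ∃ κ : ℝ, 0 ≤ κ ∧ κ ≤ Nat.card F ∧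
    ∀ H : Subgroup (GL (Fin n) F), slSubgroup n F ≤ H → ∀ a : GL (Fin n) F,
      ∃ Δ : Finset Fˣ, Δ.Nonempty ∧ rsProportion (a • (H : Set (GL (Fin n) F))) =
        κ * ((∑ δ ∈ Δ, rsWeight n ((-1) ^ n * (δ : F))) / Δ.card) := by
  classical
  have := Fintype.ofFinite F
  let det : GL (Fin n) F →* Fˣ := Matrix.GeneralLinearGroup.det
  let N : ℕ := (Finset.univ.filter fun g => det g = 1).card
  have hN : 0 < N := Finset.card_pos.2 ⟨1, by simp⟩
  have hfib : ∀ g : GL (Fin n) F, (Finset.univ.filter fun g' => det g' = det g).card = N :=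
    fun g => MonoidHom.card_fiber_eq_of_mem_range det ⟨g, rfl⟩ ⟨1, map_one _⟩
  have hle : Nat.card (GL (Fin n) F) ≤ Nat.card F * N := by
    rw [Nat.card_eq_fintype_card, ← Finset.card_univ,
      Finset.card_eq_sum_card_fiberwise (f := det) (t := Finset.univ) (by simp)]
    refine (Finset.sum_le_card_nsmul _ _ N fun δ _ => ?_).trans ?_
    · by_cases hδ : ∃ g, det g = δ
      · obtain ⟨g, rfl⟩ := hδ
        exact (hfib g).le
      · rw [Finset.filter_false_of_mem fun g _ h => hδ ⟨g, h⟩]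
        exact Nat.zero_le _
    · rw [smul_eq_mul, Finset.card_univ, ← Nat.card_eq_fintype_card]
      exact Nat.mul_le_mul_right _ (Nat.card_le_card_of_injective _ Units.val_injective)
  have hNR : (0 : ℝ) < N := Nat.cast_pos.2 hN
  refine ⟨Nat.card (GL (Fin n) F) / N, by positivity, ?_, fun H hH a => ?_⟩
  · rw [div_le_iff₀ hNR]
    exact_mod_cast hle
  set S := a • (H : Set (GL (Fin n) F)) with hS
  have haS : a ∈ S := ⟨1, H.one_mem, mul_one a⟩
  let Δ : Finset Fˣ := Finset.univ.filter fun δ => ∃ g ∈ S, det g = δ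
  have hmaps : ∀ g ∈ S, det g ∈ Δ := fun g hg => by simpa [Δ] using ⟨g, hg, rfl⟩
  have hmem : ∀ δ ∈ Δ, ∀ g, det g = δ → g ∈ S := by
    intro δ hδ g hg
    obtain ⟨g', hg', rfl⟩ := (Finset.mem_filter.1 hδ).2
    exact mem_coset_of_det_eq hH hg' hg
  have hcount : ∀ P : GL (Fin n) F → Prop, {x ∈ S | P x}.ncard =
      ∑ δ ∈ Δ, {g : GL (Fin n) F | P g ∧ det g = δ}.ncard := by
    intro P
    have h1 : {x ∈ S | P x}.ncard = (Finset.univ.filter fun x => x ∈ S ∧ P x).card := by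
      rw [← Set.ncard_coe_finset]; simp
    rw [h1, Finset.card_eq_sum_card_fiberwise (f := det) (t := Δ)]
    · refine Finset.sum_congr rfl fun δ hδ => ?_
      rw [← Set.ncard_coe_finset]
      congr 1
      ext g
      simp only [Finset.coe_filter, Finset.mem_filter, Finset.mem_univ, true_and,
        Set.mem_ofPred_eq]
      exact ⟨fun h => ⟨h.1.2, h.2⟩, fun h => ⟨⟨hmem δ hδ g h.2, h.1⟩, h.2⟩⟩
    · intro g hg
      simp only [Finset.coe_filter, Finset.mem_univ, true_and, Set.mem_ofPred_eq] at hg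
      exact hmaps g hg.1
  have hScard : S.ncard = Δ.card * N := by
    have h1 := hcount fun _ => True
    simp only [and_true, true_and, Set.ofPred_mem_eq] at h1
    rw [h1, Finset.sum_const_nat]
    intro δ hδ
    obtain ⟨g, -, rfl⟩ := (Finset.mem_filter.1 hδ).2
    rw [← hfib g, ← Set.ncard_coe_finset]
    simp
  have hΔ : Δ.Nonempty := ⟨det a, hmaps a haS⟩
  have hΔR : (0 : ℝ) < Δ.card := Nat.cast_pos.2 hΔ.card_pos
  refine ⟨Δ, hΔ, ?_⟩
  rw [rsProportion, hcount, hScard, Nat.cast_sum,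
    Finset.sum_congr rfl fun δ _ => ncard_isRegularSemisimpleGL_det_eq δ, ← Finset.mul_sum,
    Nat.cast_mul]
  field_simp

theorem isRegularSemisimpleGL_of_dim_one (g : GL (Fin 1) F) : IsRegularSemisimpleGL g := by
  rw [isRegularSemisimpleGL_iff]
  generalize (g : Matrix (Fin 1) (Fin 1) F) = M
  have hmon := Matrix.charpoly_monic M
  have hdeg : M.charpoly.degree = 1 := by
    rw [Matrix.charpoly_degree_eq_dim, Fintype.card_fin, Nat.cast_one]
  have hirr : Irreducible M.charpoly := irreducible_of_degree_eq_one hdeg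
  have h1 := minpoly.eq_of_irreducible_of_monic hirr (Matrix.aeval_self_charpoly M) hmon
  exact ⟨h1.symm, hirr.squarefree⟩

theorem rsProportion_coset_of_dim_one [Finite F] (H : Subgroup (GL (Fin 1) F))
    (a : GL (Fin 1) F) : rsProportion (a • (H : Set (GL (Fin 1) F))) = 1 := by
  have hne : (a • (H : Set (GL (Fin 1) F))).ncard ≠ 0 :=
    ((Set.ncard_pos (Set.toFinite _)).2 ⟨a, Set.mem_smul_set.2 ⟨1, H.one_mem, mul_one a⟩⟩).ne'
  simp only [rsProportion, isRegularSemisimpleGL_of_dim_one, and_true, Set.ofPred_mem_eq]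
  exact div_self (Nat.cast_ne_zero.2 hne)

end Cosets

theorem abs_sum_div_card_sub_le {ι : Type*} {s : Finset ι} (hs : s.Nonempty) {u : ι → ℝ}
    {x ε : ℝ} (h : ∀ i ∈ s, |u i - x| ≤ ε) : |(∑ i ∈ s, u i) / s.card - x| ≤ ε := by
  have hpos : (0 : ℝ) < s.card := Nat.cast_pos.2 hs.card_pos
  have h1 : (∑ i ∈ s, u i) / s.card - x = (∑ i ∈ s, (u i - x)) / s.card := by
    rw [Finset.sum_sub_distrib, Finset.sum_const, nsmul_eq_mul]
    field_simp
  rw [h1, abs_div, Nat.abs_cast, div_le_iff₀ hpos]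
  refine (Finset.abs_sum_le_sum_abs _ _).trans ((Finset.sum_le_card_nsmul _ _ ε h).trans ?_)
  rw [nsmul_eq_mul, mul_comm]

theorem mainTheorem11 (q : ℕ) :
    ∃ c : ℝ, ∀ (F : Type*) [Field F] [Fintype F], Fintype.card F = q →
      ∀ n : ℕ, 1 ≤ n → ∀ H : Subgroup (GL (Fin n) F), slSubgroup n F ≤ H →
        ∀ a b : GL (Fin n) F,
          |rsProportion (a • (H : Set (GL (Fin n) F))) -
              rsProportion (b • (H : Set (GL (Fin n) F)))| ≤
            c * Real.log (n : ℝ) ^ 3 / (n : ℝ) ^ (1 / 2 : ℝ) := by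
  by_cases hq : 2 ≤ q
  swap
  -- no field has fewer than two elements
  · exact ⟨0, fun F _ _ hF => absurd (hF ▸ Fintype.one_lt_card (α := F)) hq⟩
  obtain ⟨C, hC⟩ := exists_abs_rsWeight_sub_le hq
  have hlog2 : 0 < Real.log 2 := Real.log_pos one_lt_two
  -- a bound `2 * q * |C| / n` is stronger than required once `n ≥ 2`, since `log n ≥ log 2`
  refine ⟨2 * q * |C| / Real.log 2 ^ 3, fun F _ _ hF n hn H hH a b => ?_⟩
  have hF' : Nat.card F = q := by rw [Nat.card_eq_fintype_card, hF]
  rcases hn.eq_or_lt with rfl | hn2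
  -- the bound is `0` for `n = 1`, as `log 1 = 0`, and every element is regular semisimple
  · simp [rsProportion_coset_of_dim_one]
  have hn0 : (0 : ℝ) < n := by exact_mod_cast hn
  obtain ⟨κ, hκ0, hκ, hcos⟩ := exists_rsProportion_coset_eq (F := F) (n := n)
  have hsign : ((-1 : F) ^ n) ≠ 0 := by simp
  -- every coset has nearly the proportion predicted by the constant term `(-1) ^ n`
  have key : ∀ a : GL (Fin n) F, |rsProportion (a • (H : Set (GL (Fin n) F))) -
      κ * rsWeight n ((-1 : F) ^ n)| ≤ q * (|C| / n) := by
    intro a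
    obtain ⟨Δ, hΔ, hprop⟩ := hcos H hH a
    rw [hprop, ← mul_sub, abs_mul, abs_of_nonneg hκ0]
    refine mul_le_mul (hF' ▸ hκ) (abs_sum_div_card_sub_le hΔ fun δ _ => ?_) (abs_nonneg _)
      (Nat.cast_nonneg q)
    rw [le_div_iff₀' hn0]
    exact (hC F hF' n _ _ (mul_ne_zero hsign δ.ne_zero) hsign).trans (le_abs_self C)
  have hdiff : |rsProportion (a • (H : Set (GL (Fin n) F))) -
      rsProportion (b • (H : Set (GL (Fin n) F)))| ≤ 2 * q * |C| / n := by
    refine (abs_sub_le _ (κ * rsWeight n ((-1 : F) ^ n)) _).trans ?_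
    have hb := key b
    rw [abs_sub_comm] at hb
    exact (add_le_add (key a) hb).trans (le_of_eq (by ring))
  refine hdiff.trans ?_
  have hlog : 1 ≤ (Real.log n / Real.log 2) ^ 3 := by
    refine one_le_pow₀ ((one_le_div hlog2).2 (Real.log_le_log two_pos ?_))
    exact_mod_cast hn2
  have hsqrt : (n : ℝ) ^ (1 / 2 : ℝ) ≤ n := by
    conv_rhs => rw [← Real.rpow_one (n : ℝ)]
    exact Real.rpow_le_rpow_of_exponent_le (by exact_mod_cast hn) (by norm_num)
  have hspos : 0 < (n : ℝ) ^ (1 / 2 : ℝ) := Real.rpow_pos_of_pos hn0 _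
  calc 2 * q * |C| / n ≤ 2 * q * |C| / (n : ℝ) ^ (1 / 2 : ℝ) := by gcongr
    _ ≤ 2 * q * |C| * (Real.log n / Real.log 2) ^ 3 / (n : ℝ) ^ (1 / 2 : ℝ) := by
        refine div_le_div_of_nonneg_right ?_ hspos.le
        exact le_mul_of_one_le_right (by positivity) hlog
    _ = _ := by rw [div_pow]; ring
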